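/- Let $p \ge 13$ be a prime, let $G = \mathrm{SL}(2,p)$, let $U \le G$ be the subgroup of upper triangular matrices, and let $H_2 \le U$ be the subgroup of those elements of $U$ whose diagonal entries are (non-zero) squares in $\mathbb{F}_p$ (equivalently, the unique subgroup of index $2$ in $U$). For a subgroup $H \le G$, call $(G,H)$ a strong Gelfand pair if every irreducible complex character of $H$ induces a multiplicity-free character of $G$, that is, $\langle \chi, \psi{\uparrow}^G\rangle \le 1$ for all irreducible complex characters $\chi$ of $G$ and $\psi$ of $H$. Then: 1. For every proper subgroup $K$ of $U$ with $K \ne H_2$, $(G,K)$ is not a strong Gelfand pair. 2. If $p \equiv 1 \pmod 4$, then $(G,H_2)$ is not a strong Gelfand pair. 3. If $p \equiv 3 \pmod 4$, then $(G,H_2)$ is a strong Gelfand pair. 4. For every proper subgroup $K$ of $H_2$, $(G,K)$ is not a strong Gelfand pair. -/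

import Mathlib

noncomputable section

namespace StrongGelfand

/-- `χ` is the character of an irreducible (finite-dimensional) complex representation of `G`.
Every finite-dimensional representation is isomorphic to one on some `ℂⁿ`. -/
def IsIrreducibleCharacter {G : Type*} [Group G] (χ : G → ℂ) : Prop :=
  ∃ (n : ℕ) (ρ : Representation ℂ G (Fin n → ℂ)), ρ.IsIrreducible ∧ χ = ρ.character

/-- The inner product `⟨χ, ψ⟩ = |G|⁻¹ ∑ g, χ(g) * ψ(g⁻¹)` of characters of a finite group
(`ψ(g⁻¹)` is the complex conjugate of `ψ(g)` when `ψ` is a character). -/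
def innerProduct {G : Type*} [Group G] [Fintype G] (χ ψ : G → ℂ) : ℂ :=
  (Nat.card G : ℂ)⁻¹ * ∑ g : G, χ g * ψ g⁻¹

open scoped Classical in
/-- The function on `G` induced from a function `ψ` on the subgroup `H`:
`(ψ↑ᴳ)(g) = |H|⁻¹ ∑ x, ψ°(x⁻¹ g x)`, where `ψ°` extends `ψ` to `G` by zero. -/
def induced {G : Type*} [Group G] [Fintype G] (H : Subgroup G) (ψ : H → ℂ) (g : G) : ℂ :=
  (Nat.card H : ℂ)⁻¹ *
    ∑ x : G, if h : x⁻¹ * g * x ∈ H then ψ ⟨x⁻¹ * g * x, h⟩ else 0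

open scoped ComplexOrder in
/-- `(G, H)` is a strong Gelfand pair: every irreducible character of `H` induces a
multiplicity-free character of `G`, that is, `⟨χ, ψ↑ᴳ⟩ ≤ 1` for all irreducible characters `χ` of
`G` and `ψ` of `H`. -/
def IsStrongGelfandPair {G : Type*} [Group G] [Fintype G] (H : Subgroup G) : Prop :=
  ∀ (χ : G → ℂ) (ψ : H → ℂ), IsIrreducibleCharacter χ → IsIrreducibleCharacter ψ →
    innerProduct χ (induced H ψ) ≤ 1

open scoped MatrixGroups

/-- The subgroup `U` of upper triangular matrices in `SL(2, F)`. -/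
def upperTriangular (F : Type*) [Field F] : Subgroup SL(2, F) where
  carrier := {g | g 1 0 = 0}
  one_mem' := by simp
  mul_mem' := by
    intro a b ha hb
    simp only [Set.mem_ofPred_eq] at ha hb ⊢
    simp [Matrix.mul_apply, Fin.sum_univ_two, ha, hb]
  inv_mem' := by
    intro a ha
    simp only [Set.mem_ofPred_eq] at ha ⊢
    simp [Matrix.SpecialLinearGroup.coe_inv, Matrix.adjugate_fin_two, ha]

/-- The subgroup `H₂` of those upper triangular matrices in `SL(2, F)` whose diagonal entries are
squares in `F` (these entries are automatically non-zero). -/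
def upperTriangularSquare (F : Type*) [Field F] : Subgroup SL(2, F) where
  carrier := {g | g 1 0 = 0 ∧ IsSquare (g 0 0) ∧ IsSquare (g 1 1)}
  one_mem' := by simp
  mul_mem' := by
    rintro a b ⟨ha, ha0, ha1⟩ ⟨hb, hb0, hb1⟩
    refine ⟨?_, ?_, ?_⟩
    · simp [Matrix.mul_apply, Fin.sum_univ_two, ha, hb]
    · simpa [Matrix.mul_apply, Fin.sum_univ_two, ha, hb] using ha0.mul hb0
    · simpa [Matrix.mul_apply, Fin.sum_univ_two, ha, hb] using ha1.mul hb1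
  inv_mem' := by
    rintro a ⟨ha, ha0, ha1⟩
    refine ⟨?_, ?_, ?_⟩
    · simp [Matrix.SpecialLinearGroup.coe_inv, Matrix.adjugate_fin_two, ha]
    · simpa [Matrix.SpecialLinearGroup.coe_inv, Matrix.adjugate_fin_two] using ha1
    · simpa [Matrix.SpecialLinearGroup.coe_inv, Matrix.adjugate_fin_two] using ha0

end StrongGelfand

end

/-!
Write `H₂ ≤ U ≤ G = SL(2, F)` with `F = ZMod p`. By Maschke's theorem, Schur's lemma and the density
theorem, `(G, H)` is a strong Gelfand pair if and only if the centralizer of `ℂ[H]` in `ℂ[G]`, here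
called `heckeAlgebra H`, is commutative
(`IsStrongGelfandPair.commute_heckeAlgebra`, `isStrongGelfandPair_of_commute`). This turns the
question about characters into one about conjugacy, and the character table of `G` is not needed.

Negative results: commutativity of class sums forces every product `x * y` to be of the form
`y' * x'` with `y'`, `x'` being `H`-conjugate to `y`, `x` (`IsStrongGelfandPair.exists_mul_eq`).
Suitable pairs `x`, `y` show that the diagonal entries of a subgroup `K ≤ U` giving a strong Gelfand
pair exhaust `Fˣ` up to sign (`IsStrongGelfandPair.exists_sq_eq`), and that `K` is not contained in
a conjugate of the diagonal torus (`not_isStrongGelfandPair_of_torus`). The first fact excludes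
`H₂` when `-1` is a square. Together they leave only `U` and `H₂`: a subgroup of `U` without
unipotent elements other than `1` lies in such a torus, while one with such an element contains all
upper unipotent matrices as `p` is prime, and is then determined by its diagonal entries.

Positive result: if `-1` is not a square, then `U = H₂ × {±1}`, so `heckeAlgebra H₂` equals
`heckeAlgebra U`. Reflection in the antidiagonal is an anti-involution preserving the
`U`-conjugacy classes outside `U`, and the functions supported on `U` are central in
`heckeAlgebra U`, so that Gelfand's trick applies (`commute_heckeAlgebra_of_antiinvolution`).
-/

namespace StrongGelfand

open Representation
open scoped MonoidAlgebra

/-! ### Irreducible characters and Frobenius reciprocity -/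

theorem isIrreducible_of_equiv {k G V W : Type*} [Field k] [Monoid G] [AddCommGroup V] [Module k V]
    [AddCommGroup W] [Module k W] {ρ : Representation k G V} {σ : Representation k G W}
    (e : ρ.Equiv σ) [ρ.IsIrreducible] : σ.IsIrreducible := by
  rw [irreducible_iff_isSimpleModule_asModule]
  let f := IntertwiningMap.equivLinearMapAsModule ρ σ e.toIntertwiningMap
  have hf : Function.Bijective f := (e.toLinearEquiv).bijective
  exact IsSimpleModule.congr (LinearEquiv.ofBijective f hf).symm

theorem exists_equiv_fin {G V : Type*} [Group G] [AddCommGroup V] [Module ℂ V]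
    [FiniteDimensional ℂ V] (ρ : Representation ℂ G V) :
    ∃ (n : ℕ) (σ : Representation ℂ G (Fin n → ℂ)), Nonempty (ρ.Equiv σ) := by
  let e : V ≃ₗ[ℂ] (Fin (Module.finrank ℂ V) → ℂ) := (Module.finBasis ℂ V).equivFun
  refine ⟨_, (MonoidHomClass.toMonoidHom (e.conjAlgEquiv ℂ)).comp ρ,
    ⟨Representation.Equiv.mk e fun g => ?_⟩⟩
  ext v
  simp [LinearEquiv.conjAlgEquiv_apply]

theorem isIrreducibleCharacter_character {G V : Type*} [Group G] [AddCommGroup V] [Module ℂ V]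
    [FiniteDimensional ℂ V] (ρ : Representation ℂ G V) [ρ.IsIrreducible] :
    IsIrreducibleCharacter ρ.character := by
  obtain ⟨n, σ, ⟨e⟩⟩ := exists_equiv_fin ρ
  exact ⟨n, σ, isIrreducible_of_equiv e, char_iso e⟩

/-- Frobenius reciprocity for class functions: each of the `|G|` conjugating elements in the
definition of the induced function contributes the same sum over `H`. -/
theorem innerProduct_induced {G : Type*} [Group G] [Fintype G] (H : Subgroup G) [Fintype H]
    {χ : G → ℂ} (hχ : ∀ g x, χ (x * g * x⁻¹) = χ g) (ψ : H → ℂ) :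
    innerProduct χ (induced H ψ) = innerProduct (fun h : H => χ h) ψ := by
  classical
  have key (x : G) : ∑ g : G, χ g *
      (if h : x⁻¹ * g⁻¹ * x ∈ H then ψ ⟨x⁻¹ * g⁻¹ * x, h⟩ else 0) = ∑ h : H, χ h * ψ h⁻¹ := by
    rw [← (MulAut.conj x).toEquiv.sum_comp]
    have hinv (g : G) : x⁻¹ * ((MulAut.conj x).toEquiv g)⁻¹ * x = g⁻¹ := by
      simp [mul_assoc]
    have hinvar (g : G) : χ ((MulAut.conj x).toEquiv g) = χ g := hχ g x
    simp_rw [hinv, hinvar]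
    refine (Fintype.sum_of_injective Subtype.val Subtype.val_injective _ _ ?_ ?_).symm
    · intro g hg
      have hg' : g⁻¹ ∉ H := by simpa using hg
      rw [dif_neg hg', mul_zero]
    · intro h
      rw [dif_pos (H.inv_mem h.2)]
      rfl
  have hG : (Nat.card G : ℂ) ≠ 0 := by simp
  calc innerProduct χ (induced H ψ)
      = (Nat.card G : ℂ)⁻¹ * ∑ g : G, ∑ x : G, (Nat.card H : ℂ)⁻¹ * (χ g *
        (if h : x⁻¹ * g⁻¹ * x ∈ H then ψ ⟨x⁻¹ * g⁻¹ * x, h⟩ else 0)) := by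
        simp only [innerProduct, induced, Finset.mul_sum]
        refine Finset.sum_congr rfl fun g _ => Finset.sum_congr rfl fun x _ => ?_
        rw [mul_left_comm (χ g)]
    _ = innerProduct (fun h : H => χ h) ψ := by
        rw [Finset.sum_comm]
        simp_rw [← Finset.mul_sum, key]
        rw [Finset.sum_const, Finset.card_univ, nsmul_eq_mul, ← Nat.card_eq_fintype_card,
          mul_left_comm (Nat.card H : ℂ)⁻¹, inv_mul_cancel_left₀ hG]
        rfl

theorem innerProduct_character_induced {G V W : Type*} [Group G] [Fintype G] (H : Subgroup G)
    [AddCommGroup V] [Module ℂ V] [FiniteDimensional ℂ V]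
    [AddCommGroup W] [Module ℂ W] [FiniteDimensional ℂ W]
    (ρ : Representation ℂ G V) (σ : Representation ℂ H W) :
    innerProduct ρ.character (induced H σ.character) =
      Module.finrank ℂ (IntertwiningMap σ (ρ.comp H.subtype)) := by
  classical
  have : Invertible (Nat.card H : ℂ) := invertibleOfNonzero (by simp [Nat.card_eq_fintype_card])
  rw [innerProduct_induced H (fun g x => ρ.char_conj g x),
    ← card_inv_mul_sum_char_mul_char_eq_finrank]
  rfl

open scoped ComplexOrder in
theorem IsStrongGelfandPair.finrank_le_one {G V W : Type*} [Group G] [Fintype G] {H : Subgroup G}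
    (h : IsStrongGelfandPair H) [AddCommGroup V] [Module ℂ V] [FiniteDimensional ℂ V]
    [AddCommGroup W] [Module ℂ W] [FiniteDimensional ℂ W] (ρ : Representation ℂ G V)
    (σ : Representation ℂ H W) [ρ.IsIrreducible] [σ.IsIrreducible] :
    Module.finrank ℂ (IntertwiningMap σ (ρ.comp H.subtype)) ≤ 1 := by
  have hle := h _ _ (isIrreducibleCharacter_character ρ) (isIrreducibleCharacter_character σ)
  rw [innerProduct_character_induced] at hle
  exact Nat.cast_le_one.mp hle

/-! ### Multiplicity-freeness and the Hecke algebra -/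

/-- A semisimple module is spanned by its simple submodules. -/
theorem eq_zero_of_forall_simple {R M N : Type*} [Ring R] [AddCommGroup M] [Module R M]
    [IsSemisimpleModule R M] [AddCommGroup N] (f : M →+ N)
    (h : ∀ S : Submodule R M, IsSimpleModule R S → ∀ x ∈ S, f x = 0) : f = 0 := by
  ext x
  have hx : x ∈ sSup {S : Submodule R M | IsSimpleModule R S} := by
    rw [IsSemisimpleModule.sSup_simples_eq_top]; trivial
  rw [sSup_eq_iSup'] at hx
  refine Submodule.iSup_induction _ (motive := fun x => f x = 0) hx
    (fun S x hx => h S.1 S.2 x hx) (map_zero f) fun x y hx hy => ?_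
  rw [map_add, hx, hy, add_zero]

/-- The centralizer of `ℂ[H]` in `ℂ[G]`, that is, the convolution algebra of the functions on `G`
that are constant on `H`-conjugacy classes. It is the Hecke algebra of `G × H` with respect to the
diagonal copy of `H`. -/
noncomputable def heckeAlgebra {G : Type*} [Group G] (H : Subgroup G) : Subalgebra ℂ ℂ[G] :=
  Subalgebra.centralizer ℂ (MonoidAlgebra.of ℂ G '' H)

theorem mem_heckeAlgebra_iff {G : Type*} [Group G] {H : Subgroup G} {a : ℂ[G]} :
    a ∈ heckeAlgebra H ↔
      ∀ h ∈ H, MonoidAlgebra.of ℂ G h * a = a * MonoidAlgebra.of ℂ G h := by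
  simp [heckeAlgebra, Subalgebra.mem_centralizer_iff]

theorem ofModule'_asAlgebraHom_apply {k G M : Type*} [Field k] [Monoid G] [AddCommGroup M]
    [Module k M] [Module k[G] M] [IsScalarTower k k[G] M] (r : k[G]) (x : M) :
    (ofModule' (k := k) (G := G) M).asAlgebraHom r x = r • x := by
  simp [ofModule', asAlgebraHom]

theorem isIrreducible_ofModule' {k G M : Type*} [Field k] [Monoid G] [AddCommGroup M]
    [Module k M] [Module k[G] M] [IsScalarTower k k[G] M] [h : IsSimpleModule k[G] M] :
    (ofModule' (k := k) (G := G) M).IsIrreducible := by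
  rw [irreducible_iff_isSimpleModule_asModule]
  let e : (ofModule' (k := k) (G := G) M).asModule ≃ₗ[k[G]] M :=
    { toFun := fun x => x
      invFun := fun x => x
      map_add' := fun _ _ => rfl
      map_smul' := fun r x => ofModule'_asAlgebraHom_apply (M := M) r x
      left_inv := fun _ => rfl
      right_inv := fun _ => rfl }
  exact IsSimpleModule.congr e

theorem finiteDimensional_submodule {k A M : Type*} [Field k] [Ring A] [Algebra k A]
    [AddCommGroup M] [Module k M] [Module A M] [IsScalarTower k A M] [FiniteDimensional k M]
    (S : Submodule A M) : FiniteDimensional k S :=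
  FiniteDimensional.of_injective (S.subtype.restrictScalars k) Subtype.val_injective

/-- The inclusion of a `ℂ[H]`-submodule of a representation, as an intertwining map. -/
noncomputable def subtypeIntertwining {H V : Type*} [Group H] [AddCommGroup V] [Module ℂ V]
    (τ : Representation ℂ H V) (S : Submodule ℂ[H] τ.asModule) :
    IntertwiningMap (ofModule' (k := ℂ) (G := H) S) τ where
  toLinearMap := τ.asModuleEquiv.toLinearMap ∘ₗ S.subtype.restrictScalars ℂ
  isIntertwining' h := by
    ext y
    simp [ofModule']
    rfl

theorem exists_eq_smul_of_finrank_le_one {K V : Type*} [Field K] [AddCommGroup V] [Module K V]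
    [FiniteDimensional K V] (h : Module.finrank K V ≤ 1) {i : V} (hi : i ≠ 0) (w : V) :
    ∃ c : K, w = c • i := by
  obtain ⟨v, hv⟩ := finrank_le_one_iff.mp h
  obtain ⟨a, rfl⟩ := hv i
  obtain ⟨b, rfl⟩ := hv w
  refine ⟨b * a⁻¹, ?_⟩
  have ha : a ≠ 0 := fun ha => hi (by simp [ha])
  rw [smul_smul, inv_mul_cancel_right₀ ha]

/-- For a strong Gelfand pair the `H`-endomorphisms of an irreducible representation of `G` commute:
on each simple `H`-submodule `S` they act by scalars, because `Hom_H(S, V)` is one-dimensional, and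
the simple submodules span `V`. -/
theorem IsStrongGelfandPair.commute_intertwiningMap {G V : Type*} [Group G] [Fintype G]
    {H : Subgroup G} (hH : IsStrongGelfandPair H) [AddCommGroup V] [Module ℂ V]
    [FiniteDimensional ℂ V] (ρ : Representation ℂ G V) [ρ.IsIrreducible]
    (A B : IntertwiningMap (ρ.comp H.subtype) (ρ.comp H.subtype)) (x : V) :
    A (B x) = B (A x) := by
  let τ : Representation ℂ H V := ρ.comp H.subtype
  have hz : (((A.comp B).toLinearMap - (B.comp A).toLinearMap).toAddMonoidHom :
      τ.asModule →+ V) = 0 := by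
    refine eq_zero_of_forall_simple (R := ℂ[H]) (M := τ.asModule) _ fun S hS x hx => ?_
    let σ : Representation ℂ H S := ofModule' S
    have : σ.IsIrreducible := isIrreducible_ofModule'
    have : FiniteDimensional ℂ S := finiteDimensional_submodule S
    let i : IntertwiningMap σ τ := subtypeIntertwining τ S
    have hscalar (C : IntertwiningMap τ τ) :
        ∃ c : ℂ, ∀ y : V, τ.asModuleEquiv.symm y ∈ S → C y = c • y := by
      by_cases hi : i = 0
      -- This case does not occur, but any scalar works in it.
      · refine ⟨0, fun y hy => ?_⟩
        have hy0 : y = 0 := congrArg (fun f : IntertwiningMap σ τ => f ⟨_, hy⟩) hi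
        rw [hy0, map_zero, smul_zero]
      · obtain ⟨c, hc⟩ := exists_eq_smul_of_finrank_le_one (hH.finrank_le_one ρ σ) hi (C.comp i)
        exact ⟨c, fun y hy => congrArg (fun f : IntertwiningMap σ τ => f ⟨_, hy⟩) hc⟩
    obtain ⟨a, ha⟩ := hscalar A
    obtain ⟨b, hb⟩ := hscalar B
    obtain ⟨y, rfl⟩ := τ.asModuleEquiv.symm.surjective x
    change A (B y) - B (A y) = 0
    rw [ha y hx, hb y hx, map_smul, map_smul, ha y hx, hb y hx, smul_comm, sub_self]
  exact sub_eq_zero.mp (DFunLike.congr_fun hz x)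

/-- Elements of the Hecke algebra act on representations of `G` by `H`-endomorphisms. -/
noncomputable def intertwiningOfMem {G V : Type*} [Group G] {H : Subgroup G} [AddCommGroup V]
    [Module ℂ V] (ρ : Representation ℂ G V) {a : ℂ[G]} (ha : a ∈ heckeAlgebra H) :
    IntertwiningMap (ρ.comp H.subtype) (ρ.comp H.subtype) where
  toLinearMap := ρ.asAlgebraHom a
  isIntertwining' h := by
    have := congrArg ρ.asAlgebraHom (mem_heckeAlgebra_iff.mp ha h h.2)
    rw [map_mul, map_mul, asAlgebraHom_of] at this
    exact this.symm

/-- The Hecke algebra of a strong Gelfand pair is commutative: commutators act by zero on every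
simple `ℂ[G]`-submodule of the semisimple ring `ℂ[G]`, so they vanish. -/
theorem IsStrongGelfandPair.commute_heckeAlgebra {G : Type*} [Group G] [Fintype G]
    {H : Subgroup G} (hH : IsStrongGelfandPair H) {a b : ℂ[G]} (ha : a ∈ heckeAlgebra H)
    (hb : b ∈ heckeAlgebra H) : a * b = b * a := by
  have hz : AddMonoidHom.mulLeft (a * b - b * a) = 0 := by
    refine eq_zero_of_forall_simple (R := ℂ[G]) _ fun S hS x hx => ?_
    let ρ : Representation ℂ G S := ofModule' S
    have : ρ.IsIrreducible := isIrreducible_ofModule'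
    have : FiniteDimensional ℂ S := finiteDimensional_submodule S
    have h := hH.commute_intertwiningMap ρ (intertwiningOfMem ρ ha) (intertwiningOfMem ρ hb)
      (⟨x, hx⟩ : S)
    have h' : a • b • (⟨x, hx⟩ : S) = b • a • (⟨x, hx⟩ : S) := by
      have hmul (c : ℂ[G]) (y : S) : ρ.asAlgebraHom c y = c • y := ofModule'_asAlgebraHom_apply c y
      rw [← hmul, ← hmul, ← hmul, ← hmul]
      exact h
    simpa [sub_mul, mul_assoc, sub_eq_zero] using congrArg Subtype.val h'
  simpa [sub_eq_zero] using DFunLike.congr_fun hz 1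

/-- Every `H`-endomorphism of an irreducible representation of `G` is given by an element of the
Hecke algebra: by the density theorem it is given by an element of `ℂ[G]`, which may be averaged
over `H`. -/
theorem exists_mem_heckeAlgebra {G V : Type*} [Group G] [Fintype G] (H : Subgroup G)
    [AddCommGroup V] [Module ℂ V] [FiniteDimensional ℂ V] (ρ : Representation ℂ G V)
    [ρ.IsIrreducible] (A : IntertwiningMap (ρ.comp H.subtype) (ρ.comp H.subtype)) :
    ∃ a ∈ heckeAlgebra H, ρ.asAlgebraHom a = A.toLinearMap := by
  classical
  obtain ⟨r, hr⟩ : ∃ r : ℂ[G], ρ.asAlgebraHom r = A.toLinearMap := by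
    let f : Module.End (Module.End ℂ[G] ρ.asModule) ρ.asModule :=
      { toFun := fun v => A v
        map_add' := fun v w => map_add A v w
        map_smul' := fun e v => by
          obtain ⟨c, rfl⟩ :=
            (IsSimpleModule.algebraMap_end_bijective_of_isAlgClosed (A := ℂ[G]) ℂ).2 e
          exact map_smul A c v }
    let b := Module.finBasis ℂ V
    obtain ⟨r, hr⟩ := jacobson_density f (Finset.univ.image fun i => (b i : ρ.asModule))
    exact ⟨r, b.ext fun i => (hr (b i) (Finset.mem_image_of_mem _ (Finset.mem_univ i))).symm⟩
  refine ⟨(Nat.card H : ℂ)⁻¹ • ∑ h : H, MonoidAlgebra.of ℂ G h * r * MonoidAlgebra.of ℂ G h⁻¹,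
    ?_, ?_⟩
  · rw [mem_heckeAlgebra_iff]
    intro k hk
    rw [mul_smul_comm, smul_mul_assoc, Finset.mul_sum, Finset.sum_mul]
    congr 1
    refine Fintype.sum_equiv (Equiv.mulLeft (⟨k, hk⟩ : H)) _ _ fun h => ?_
    have hk' : MonoidAlgebra.of ℂ G k⁻¹ * MonoidAlgebra.of ℂ G k = 1 := by
      rw [← map_mul, inv_mul_cancel, map_one]
    simp only [Equiv.coe_mulLeft, Subgroup.coe_mul, map_mul, mul_inv_rev, mul_assoc, hk', mul_one]
  · have hA (h : H) : ρ h * (A.toLinearMap * ρ (h : G)⁻¹) = A.toLinearMap := by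
      ext v
      have := A.isIntertwining _ _ h (ρ (h : G)⁻¹ v)
      have hv : (ρ.comp H.subtype) h (ρ (h : G)⁻¹ v) = v := ρ.self_inv_apply h v
      rw [hv] at this
      exact this.symm
    simp only [map_smul, map_sum, map_mul, asAlgebraHom_of, hr, mul_assoc, hA]
    rw [Finset.sum_const, Finset.card_univ, ← Nat.card_eq_fintype_card, ← Nat.cast_smul_eq_nsmul ℂ,
      smul_smul, inv_mul_cancel₀ (Nat.cast_ne_zero.mpr Nat.card_pos.ne'), one_smul]

open scoped ComplexOrder in
/-- If the Hecke algebra is commutative, then `(G, H)` is a strong Gelfand pair. -/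
theorem isStrongGelfandPair_of_commute {G : Type*} [Group G] [Fintype G] {H : Subgroup G}
    (hcomm : ∀ a ∈ heckeAlgebra H, ∀ b ∈ heckeAlgebra H, a * b = b * a) :
    IsStrongGelfandPair H := by
  rintro _ _ ⟨n, ρ, hρ, rfl⟩ ⟨m, σ, hσ, rfl⟩
  rw [innerProduct_character_induced]
  refine Nat.cast_le_one.mpr ?_
  let τ : Representation ℂ H (Fin n → ℂ) := ρ.comp H.subtype
  have hend (A B : IntertwiningMap τ τ) : A.comp B = B.comp A := by
    obtain ⟨a, ha, haA⟩ := exists_mem_heckeAlgebra H ρ A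
    obtain ⟨b, hb, hbB⟩ := exists_mem_heckeAlgebra H ρ B
    ext1
    have := congrArg ρ.asAlgebraHom (hcomm a ha b hb)
    rwa [map_mul, map_mul, haA, hbB] at this
  by_cases h0 : ∀ φ : IntertwiningMap σ τ, φ = 0
  · exact finrank_le_one 0 fun φ : IntertwiningMap σ τ => ⟨0, by rw [h0 φ, smul_zero]⟩
  push Not at h0
  obtain ⟨φ, hφ⟩ := h0
  have hinj := (IsIrreducible.injective_or_eq_zero φ).resolve_right hφ
  obtain ⟨g, hg⟩ := MonoidAlgebra.exists_leftInverse_of_injective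
    (IntertwiningMap.equivLinearMapAsModule σ τ φ) (LinearMap.ker_eq_bot.mpr hinj)
  let θ : IntertwiningMap τ σ := (IntertwiningMap.equivLinearMapAsModule τ σ).symm g
  have hθ (w) : θ (φ w) = w := LinearMap.congr_fun hg w
  -- For a second map `ψ`, compare the endomorphisms `φ ∘ θ` and `ψ ∘ θ`; by Schur's lemma `θ ∘ ψ`
  -- is a scalar.
  refine finrank_le_one φ fun ψ => ?_
  obtain ⟨c, hc⟩ := (IsIrreducible.algebraMap_intertwiningMap_bijective_of_isAlgClosed
    (ρ := σ) (k := ℂ)).2 (θ.comp ψ)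
  refine ⟨c, ?_⟩
  ext1
  refine LinearMap.ext fun w => ?_
  have h1 : φ (θ (ψ (θ (φ w)))) = ψ (θ (φ (θ (φ w)))) :=
    congrArg (fun f : IntertwiningMap τ τ => f (φ w)) (hend (φ.comp θ) (ψ.comp θ))
  have h2 : c • w = θ (ψ w) := congrArg (fun f : IntertwiningMap σ σ => f w) hc
  rw [hθ, hθ, ← h2, map_smul] at h1
  exact h1

/-! ### Commutativity of the Hecke algebra -/

theorem coeff_conj_of_mem_heckeAlgebra {G : Type*} [Group G] {H : Subgroup G} {a : ℂ[G]}
    (ha : a ∈ heckeAlgebra H) {h : G} (hh : h ∈ H) (g : G) :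
    a.coeff (h * g * h⁻¹) = a.coeff g := by
  have := congrArg (fun b : ℂ[G] => b.coeff (h * g)) (mem_heckeAlgebra_iff.mp ha h hh)
  simpa [mul_assoc] using this.symm

theorem mem_heckeAlgebra_of_coeff_conj {G : Type*} [Group G] {H : Subgroup G} {a : ℂ[G]}
    (ha : ∀ h ∈ H, ∀ g, a.coeff (h * g * h⁻¹) = a.coeff g) : a ∈ heckeAlgebra H := by
  rw [mem_heckeAlgebra_iff]
  intro h hh
  ext g
  have := ha h hh (h⁻¹ * g)
  simp only [mul_inv_cancel_left] at this
  simp [this]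

theorem coeff_mul_eq_sum {G : Type*} [Group G] [Fintype G] (a b : ℂ[G]) (t : G) :
    (a * b).coeff t = ∑ x : G, a.coeff x * b.coeff (x⁻¹ * t) := by
  rw [MonoidAlgebra.coeff_mul_apply_left, Finsupp.sum_fintype _ _ (by simp)]

/-- The sum of the `H`-conjugates of `x` in `ℂ[G]`, counted with multiplicity. -/
noncomputable def conjSum {G : Type*} [Group G] (H : Subgroup G) [Fintype H] (x : G) : ℂ[G] :=
  ∑ h : H, MonoidAlgebra.of ℂ G (h * x * h⁻¹)

theorem conjSum_mem_heckeAlgebra {G : Type*} [Group G] (H : Subgroup G) [Fintype H] (x : G) :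
    conjSum H x ∈ heckeAlgebra H := by
  rw [mem_heckeAlgebra_iff]
  intro k hk
  rw [conjSum, Finset.mul_sum, Finset.sum_mul]
  refine Fintype.sum_equiv (Equiv.mulLeft (⟨k, hk⟩ : H)) _ _ fun h => ?_
  rw [← map_mul, ← map_mul]
  congr 1
  simp [mul_assoc]

/-- An obstruction to being a strong Gelfand pair: `x * y` occurs in the product of the `H`-class
sums of `x` and `y`, hence also in the product in the opposite order. -/
theorem IsStrongGelfandPair.exists_mul_eq {G : Type*} [Group G] [Fintype G] {H : Subgroup G}
    (hH : IsStrongGelfandPair H) (x y : G) :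
    ∃ k ∈ H, ∃ l ∈ H, x * y = (k * y * k⁻¹) * (l * x * l⁻¹) := by
  classical
  by_contra! hne
  have hcomm := congrArg (fun a : ℂ[G] => a.coeff (x * y))
    (hH.commute_heckeAlgebra (conjSum_mem_heckeAlgebra H x) (conjSum_mem_heckeAlgebra H y))
  have hcoeff (u v : G) : (conjSum H u * conjSum H v).coeff (x * y) =
      ((Finset.univ.filter fun q : H × H =>
        (q.1 * u * (q.1 : G)⁻¹) * (q.2 * v * (q.2 : G)⁻¹) = x * y).card : ℂ) := by
    rw [conjSum, conjSum, Finset.sum_mul_sum, ← Finset.sum_product', Finset.card_filter,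
      Nat.cast_sum, MonoidAlgebra.coeff_sum, Finsupp.finsetSum_apply]
    refine Finset.sum_congr rfl fun q _ => ?_
    rw [← map_mul, MonoidAlgebra.of_apply, MonoidAlgebra.coeff_single, Finsupp.single_apply]
    simp
  simp only [hcoeff, Nat.cast_inj] at hcomm
  have h0 : (Finset.univ.filter fun q : H × H =>
      (q.1 * y * (q.1 : G)⁻¹) * (q.2 * x * (q.2 : G)⁻¹) = x * y).card = 0 := by
    rw [Finset.card_eq_zero, Finset.filter_eq_empty_iff]
    exact fun q _ h => hne _ q.1.2 _ q.2.2 h.symm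
  rw [h0, Finset.card_eq_zero, Finset.filter_eq_empty_iff] at hcomm
  exact hcomm (Finset.mem_univ (1, 1)) (by simp)

/-- Gelfand's trick for functions fixed by an anti-involution `σ`. Off `B` the function `a * b` is
`σ`-invariant, and `σ` turns it into `b * a`; on `B` the two products agree by conjugation
invariance. -/
theorem commute_of_coeff_antiinvolution {G : Type*} [Group G] [Fintype G] {B : Subgroup G}
    (σ : G → G) (hσ : Function.Involutive σ) (hmul : ∀ x y, σ (x * y) = σ y * σ x)
    (hconj : ∀ g ∉ B, ∃ h ∈ B, σ g = h * g * h⁻¹) {a b : ℂ[G]} (ha : a ∈ heckeAlgebra B)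
    (hb : b ∈ heckeAlgebra B) (haσ : ∀ g, a.coeff (σ g) = a.coeff g)
    (hbσ : ∀ g, b.coeff (σ g) = b.coeff g) : a * b = b * a := by
  ext t
  by_cases ht : t ∈ B
  · rw [coeff_mul_eq_sum, coeff_mul_eq_sum]
    -- Reindex by `x ↦ x⁻¹ * t` and use that `a` is invariant under conjugation by `t⁻¹`.
    refine Fintype.sum_equiv ((Equiv.inv G).trans (Equiv.mulRight t)) _ _ fun x => ?_
    have := coeff_conj_of_mem_heckeAlgebra ha (B.inv_mem ht) x
    simp only [inv_inv] at this
    simp [mul_comm, this]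
  · obtain ⟨h, hh, hth⟩ := hconj t ht
    rw [← coeff_conj_of_mem_heckeAlgebra (mul_mem ha hb) hh t, ← hth, coeff_mul_eq_sum,
      coeff_mul_eq_sum]
    -- The value of `a * b` at `t` is its value at `σ t`; now reindex by `x ↦ t * (σ x)⁻¹`.
    refine Fintype.sum_equiv (((hσ.toPerm).trans (Equiv.inv G)).trans (Equiv.mulLeft t)) _ _
      fun x => ?_
    have hx : σ (x⁻¹ * σ t) = t * (σ x)⁻¹ := by
      rw [eq_mul_inv_iff_mul_eq, ← hmul, mul_inv_cancel_left, hσ]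
    rw [← hbσ, hx, ← haσ x, mul_comm]
    simp

/-- The part of an element of `ℂ[G]` supported on the subgroup `B`. -/
noncomputable def restrictTo {G : Type*} [Group G] (B : Subgroup G) [Fintype B] (a : ℂ[G]) :
    ℂ[G] :=
  ∑ u : B, a.coeff u • MonoidAlgebra.of ℂ G u

theorem coeff_restrictTo_of_mem {G : Type*} [Group G] {B : Subgroup G} [Fintype B] (a : ℂ[G])
    {g : G} (hg : g ∈ B) : (restrictTo B a).coeff g = a.coeff g := by
  classical
  rw [restrictTo, MonoidAlgebra.coeff_sum, Finsupp.finsetSum_apply,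
    Finset.sum_eq_single ⟨g, hg⟩]
  · simp
  · intro u _ hu
    have : (u : G) ≠ g := fun h => hu (Subtype.ext h)
    simp [this]
  · simp

theorem coeff_restrictTo_of_notMem {G : Type*} [Group G] {B : Subgroup G} [Fintype B] (a : ℂ[G])
    {g : G} (hg : g ∉ B) : (restrictTo B a).coeff g = 0 := by
  classical
  rw [restrictTo, MonoidAlgebra.coeff_sum, Finsupp.finsetSum_apply]
  refine Finset.sum_eq_zero fun u _ => ?_
  have : (u : G) ≠ g := fun h => hg (h ▸ u.2)
  simp [this]

theorem restrictTo_mul_comm {G : Type*} [Group G] {B : Subgroup G} [Fintype B] (a : ℂ[G])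
    {b : ℂ[G]} (hb : b ∈ heckeAlgebra B) : restrictTo B a * b = b * restrictTo B a := by
  rw [restrictTo, Finset.sum_mul, Finset.mul_sum]
  refine Finset.sum_congr rfl fun u _ => ?_
  rw [smul_mul_assoc, mul_smul_comm, mem_heckeAlgebra_iff.mp hb u u.2]

theorem restrictTo_mem_heckeAlgebra {G : Type*} [Group G] {B : Subgroup G} [Fintype B] {a : ℂ[G]}
    (ha : a ∈ heckeAlgebra B) : restrictTo B a ∈ heckeAlgebra B := by
  refine mem_heckeAlgebra_of_coeff_conj fun h hh g => ?_
  have hiff : h * g * h⁻¹ ∈ B ↔ g ∈ B := by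
    rw [B.mul_mem_cancel_right (B.inv_mem hh), B.mul_mem_cancel_left hh]
  by_cases hg : g ∈ B
  · rw [coeff_restrictTo_of_mem a hg, coeff_restrictTo_of_mem a (hiff.mpr hg),
      coeff_conj_of_mem_heckeAlgebra ha hh]
  · rw [coeff_restrictTo_of_notMem a hg, coeff_restrictTo_of_notMem a (mt hiff.mp hg)]

/-- A variant of Gelfand's trick in which the anti-involution need only preserve the `B`-conjugacy
classes outside `B`. The parts of `a` and `b` supported on `B` lie in `ℂ[B]`, so they commute with
the whole Hecke algebra, and the remaining parts are fixed by `σ`. -/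
theorem commute_heckeAlgebra_of_antiinvolution {G : Type*} [Group G] [Fintype G] {B : Subgroup G}
    (σ : G → G) (hσ : Function.Involutive σ) (hmul : ∀ x y, σ (x * y) = σ y * σ x)
    (hconj : ∀ g ∉ B, ∃ h ∈ B, σ g = h * g * h⁻¹) {a b : ℂ[G]} (ha : a ∈ heckeAlgebra B)
    (hb : b ∈ heckeAlgebra B) : a * b = b * a := by
  classical
  have hnot {g : G} (hg : g ∉ B) : σ g ∉ B := by
    obtain ⟨h, hh, hgh⟩ := hconj g hg
    rwa [hgh, B.mul_mem_cancel_right (B.inv_mem hh), B.mul_mem_cancel_left hh]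
  have hinv {c : ℂ[G]} (hc : c ∈ heckeAlgebra B) (g : G) :
      (c - restrictTo B c).coeff (σ g) = (c - restrictTo B c).coeff g := by
    by_cases hg : g ∈ B
    · have hg' : σ g ∈ B := by
        by_contra h
        exact hnot h (by rwa [hσ])
      simp [coeff_restrictTo_of_mem c hg, coeff_restrictTo_of_mem c hg']
    · obtain ⟨h, hh, hgh⟩ := hconj g hg
      rw [hgh, coeff_conj_of_mem_heckeAlgebra
        (sub_mem hc (restrictTo_mem_heckeAlgebra hc)) hh]
  have ha' := sub_mem ha (restrictTo_mem_heckeAlgebra ha)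
  have hb' := sub_mem hb (restrictTo_mem_heckeAlgebra hb)
  have h1 : Commute (a - restrictTo B a) b := by
    have h : Commute (a - restrictTo B a) (b - restrictTo B b) :=
      commute_of_coeff_antiinvolution σ hσ hmul hconj ha' hb' (hinv ha) (hinv hb)
    have h' : Commute (a - restrictTo B a) (restrictTo B b) := (restrictTo_mul_comm b ha').symm
    simpa using h.add_right h'
  have h2 : Commute (restrictTo B a) b := restrictTo_mul_comm a hb
  simpa using (h1.add_left h2).eq

open scoped MatrixGroups

/-! ### Elements of `SL(2, F)` -/

section Field

variable {F : Type*} [Field F]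

theorem sl_mul_apply (g h : SL(2, F)) (i j : Fin 2) :
    (g * h) i j = g i 0 * h 0 j + g i 1 * h 1 j := by
  rw [Matrix.SpecialLinearGroup.coe_mul, Matrix.mul_apply, Fin.sum_univ_two]

theorem mul_eq_one_of_upper {g : SL(2, F)} (hg : g 1 0 = 0) : g 0 0 * g 1 1 = 1 := by
  have := g.det_coe
  rw [Matrix.det_fin_two, hg] at this
  simpa using this

theorem mul_apply_zero_zero_of_upper {g h : SL(2, F)} (hh : h 1 0 = 0) :
    (g * h) 0 0 = g 0 0 * h 0 0 := by
  rw [sl_mul_apply, hh, mul_zero, add_zero]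

/-- Reflection of a matrix in its antidiagonal, an anti-involution of `SL(2, F)`. -/
def antitranspose (g : SL(2, F)) : SL(2, F) :=
  ⟨!![g 1 1, g 0 1; g 1 0, g 0 0], by
    have := g.det_coe
    rw [Matrix.det_fin_two] at this
    rw [Matrix.det_fin_two_of, mul_comm (g 1 1), this]⟩

theorem antitranspose_coe (g : SL(2, F)) :
    (antitranspose g : Matrix (Fin 2) (Fin 2) F) = !![g 1 1, g 0 1; g 1 0, g 0 0] := rfl

theorem antitranspose_involutive : Function.Involutive (antitranspose (F := F)) := by
  intro g
  ext i j
  fin_cases i <;> fin_cases j <;> rfl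

theorem antitranspose_mul (x y : SL(2, F)) :
    antitranspose (x * y) = antitranspose y * antitranspose x := by
  ext i j
  fin_cases i <;> fin_cases j <;> simp [antitranspose_coe, sl_mul_apply] <;> ring

/-- The upper unipotent matrix with entry `t`. -/
def unipotent (t : F) : SL(2, F) := ⟨!![1, t; 0, 1], by simp⟩

theorem unipotent_coe (t : F) :
    (unipotent t : Matrix (Fin 2) (Fin 2) F) = !![1, t; 0, 1] := rfl

theorem unipotent_mem_upperTriangular (t : F) : unipotent t ∈ upperTriangular F :=
  show (unipotent t) 1 0 = 0 by simp [unipotent_coe]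

theorem unipotent_pow (t : F) (n : ℕ) : unipotent t ^ n = unipotent (n * t) := by
  induction n with
  | zero =>
    ext i j
    fin_cases i <;> fin_cases j <;> simp [unipotent_coe]
  | succ n ih =>
    rw [pow_succ, ih]
    ext i j
    fin_cases i <;> fin_cases j <;> simp [unipotent_coe, sl_mul_apply]
    ring

theorem eq_unipotent {g : SL(2, F)} (h10 : g 1 0 = 0) (h00 : g 0 0 = 1) :
    g = unipotent (g 0 1) := by
  have h11 := mul_eq_one_of_upper h10
  rw [h00, one_mul] at h11
  ext i j
  fin_cases i <;> fin_cases j <;> simp [unipotent_coe, h10, h00, h11]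

/-- Conjugation by unipotent matrices fixes the trace and the lower left entry `c`, and if `c ≠ 0`
it moves the upper left entry to any prescribed value. -/
theorem exists_antitranspose_eq_conj {g : SL(2, F)} (hg : g ∉ upperTriangular F) :
    ∃ h ∈ upperTriangular F, antitranspose g = h * g * h⁻¹ := by
  have hc : g 1 0 ≠ 0 := hg
  have hdet := g.det_coe
  rw [Matrix.det_fin_two] at hdet
  refine ⟨unipotent ((g 1 1 - g 0 0) / g 1 0), unipotent_mem_upperTriangular _, ?_⟩
  rw [eq_mul_inv_iff_mul_eq]
  ext i j
  fin_cases i <;> fin_cases j <;>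
    simp [antitranspose_coe, unipotent_coe, sl_mul_apply] <;> field_simp <;> ring

/-- If `K ≤ U` gives a strong Gelfand pair, then the diagonal entries of `K` exhaust `Fˣ` up to
sign. The obstruction is applied to `diag(k, k⁻¹)` and a lower unipotent matrix: upper triangular
conjugation preserves the diagonal of the former and scales the lower left entry of the latter by
the inverse square of the diagonal entry. -/
theorem IsStrongGelfandPair.exists_sq_eq [Fintype SL(2, F)] {K : Subgroup SL(2, F)}
    (hK : IsStrongGelfandPair K) (hKU : K ≤ upperTriangular F) {k : F} (hk : k ≠ 0) :
    ∃ h ∈ K, h 0 0 ^ 2 = k ^ 2 := by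
  let x : SL(2, F) := ⟨!![k, 0; 0, k⁻¹], by simp [hk]⟩
  let y : SL(2, F) := ⟨!![1, 0; 1, 1], by simp⟩
  have hx : (x : Matrix (Fin 2) (Fin 2) F) = !![k, 0; 0, k⁻¹] := rfl
  have hy : (y : Matrix (Fin 2) (Fin 2) F) = !![1, 0; 1, 1] := rfl
  obtain ⟨g, hg, l, hl, h⟩ := hK.exists_mul_eq x y
  refine ⟨g, hg, ?_⟩
  have hg0 : g 1 0 = 0 := hKU hg
  have hl0 : l 1 0 = 0 := hKU hl
  have hg1 := mul_eq_one_of_upper hg0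
  have hl1 := mul_eq_one_of_upper hl0
  have h10 := congrArg (fun z : SL(2, F) => z 1 0) h
  simp [sl_mul_apply, Matrix.adjugate_fin_two, hx, hy, hg0, hl0] at h10
  field_simp at h10
  grind

/-- The condition on `K` says that `K` lies in a conjugate of the diagonal torus by a unipotent
matrix. The obstruction is applied to two matrices whose off-diagonal entries are `1, 1` and `1, ν`;
diagonal conjugation multiplies the ratio of the cross products by squares only. -/
theorem not_isStrongGelfandPair_of_torus [Fintype SL(2, F)] {K : Subgroup SL(2, F)} (s : F)
    (hK : ∀ g ∈ K, g 1 0 = 0 ∧ g 0 1 = s * (g 0 0 - g 1 1)) {ν : F} (hν : ¬ IsSquare ν) :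
    ¬ IsStrongGelfandPair K := by
  intro hSG
  let u : SL(2, F) := unipotent (-s)
  let x : SL(2, F) := ⟨!![1, 1; 1, 2], by rw [Matrix.det_fin_two_of]; norm_num⟩
  let y : SL(2, F) := ⟨!![1, 1; ν, 1 + ν], by simp⟩
  have hx : (x : Matrix (Fin 2) (Fin 2) F) = !![1, 1; 1, 2] := rfl
  have hy : (y : Matrix (Fin 2) (Fin 2) F) = !![1, 1; ν, 1 + ν] := rfl
  obtain ⟨g, hg, l, hl, h⟩ := hSG.exists_mul_eq (u * x * u⁻¹) (u * y * u⁻¹)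
  have h' : x * y = ((u⁻¹ * g * u) * y * (u⁻¹ * g * u)⁻¹) *
      ((u⁻¹ * l * u) * x * (u⁻¹ * l * u)⁻¹) := by
    have := congrArg (fun z => u⁻¹ * z * u) h
    simpa [mul_assoc] using this
  have hdiag {g : SL(2, F)} (hg : g ∈ K) : (u⁻¹ * g * u) 0 1 = 0 ∧ (u⁻¹ * g * u) 1 0 = 0 := by
    obtain ⟨h0, h1⟩ := hK g hg
    constructor <;> simp [u, sl_mul_apply, Matrix.adjugate_fin_two, unipotent_coe, h0, h1]
    ring
  obtain ⟨hg1, hg0⟩ := hdiag hg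
  obtain ⟨hl1, hl0⟩ := hdiag hl
  have hg2 := mul_eq_one_of_upper hg0
  have hl2 := mul_eq_one_of_upper hl0
  generalize u⁻¹ * g * u = g' at *
  generalize u⁻¹ * l * u = l' at *
  have h00 := congrArg (fun z : SL(2, F) => z 0 0) h'
  simp [sl_mul_apply, Matrix.adjugate_fin_two, hx, hy, hg0, hl0, hg1, hl1, hg2, hl2] at h00
  refine hν ⟨g' 0 0 * l' 1 1, ?_⟩
  grind

end Field

/-! ### Subgroups of the upper triangular group -/

theorem isSquare_apply_one_one {F : Type*} [Field F] {g : SL(2, F)} (h10 : g 1 0 = 0)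
    (h00 : IsSquare (g 0 0)) : IsSquare (g 1 1) := by
  rw [eq_inv_of_mul_eq_one_right (mul_eq_one_of_upper h10)]
  exact h00.inv

theorem isSquare_neg_of_not_isSquare {F : Type*} [Field F] [Finite F] {a : F}
    (h1 : ¬ IsSquare (-1 : F)) (ha : ¬ IsSquare a) : IsSquare (-a) := by
  classical
  have := Fintype.ofFinite F
  have h0 : -a ≠ 0 := fun h => ha (by rw [neg_eq_zero.mp h]; exact IsSquare.zero)
  rw [← quadraticChar_neg_one_iff_not_isSquare] at h1 ha
  rw [← quadraticChar_one_iff_isSquare h0, ← neg_one_mul, map_mul, h1, ha]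
  norm_num

theorem upperTriangularSquare_le {F : Type*} [Field F] :
    upperTriangularSquare F ≤ upperTriangular F := fun _ hg => hg.1

/-- If `K` meets the unipotent group trivially, then `K` is abelian, since its commutators are
unipotent. -/
theorem mul_comm_of_forall_unipotent_mem {F : Type*} [Field F] {K : Subgroup SL(2, F)}
    (hKU : K ≤ upperTriangular F) (hN : ∀ t, unipotent t ∈ K → t = 0) {g h : SL(2, F)}
    (hg : g ∈ K) (hh : h ∈ K) : g * h = h * g := by
  have hcomm : g * h * g⁻¹ * h⁻¹ ∈ K :=
    K.mul_mem (K.mul_mem (K.mul_mem hg hh) (K.inv_mem hg)) (K.inv_mem hh)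
  have hg0 : g 1 0 = 0 := hKU hg
  have hh0 : h 1 0 = 0 := hKU hh
  have hg1 := mul_eq_one_of_upper hg0
  have hh1 := mul_eq_one_of_upper hh0
  have h00 : (g * h * g⁻¹ * h⁻¹) 0 0 = 1 := by
    rw [mul_apply_zero_zero_of_upper (hKU (K.inv_mem hh)),
      mul_apply_zero_zero_of_upper (hKU (K.inv_mem hg)), mul_apply_zero_zero_of_upper hh0]
    simp only [Matrix.SpecialLinearGroup.coe_inv, Matrix.adjugate_fin_two, Matrix.of_apply,
      Matrix.cons_val_zero, Matrix.cons_val', Matrix.cons_val_fin_one]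
    linear_combination h 0 0 * h 1 1 * hg1 + hh1
  have hu := eq_unipotent (hKU hcomm) h00
  have ht := hN _ (hu ▸ hcomm)
  rw [ht] at hu
  have h1 : unipotent (0 : F) = 1 := by simpa using (unipotent_pow (0 : F) 0).symm
  rw [h1, mul_inv_eq_one, mul_inv_eq_iff_eq_mul] at hu
  exact hu

theorem unipotent_mem_of_ne_zero {p : ℕ} [Fact p.Prime] {K : Subgroup SL(2, ZMod p)} {t : ZMod p}
    (ht : t ≠ 0) (h : unipotent t ∈ K) (s : ZMod p) : unipotent s ∈ K := by
  have hs : unipotent t ^ (s / t).val = unipotent s := by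
    rw [unipotent_pow, ZMod.natCast_zmod_val, div_mul_cancel₀ _ ht]
  exact hs ▸ K.pow_mem h _

theorem mem_of_unipotent_mem {F : Type*} [Field F] {K : Subgroup SL(2, F)}
    (hKU : K ≤ upperTriangular F) (hN : ∀ t, unipotent t ∈ K) {g h : SL(2, F)} (hh : h ∈ K)
    (hg : g 1 0 = 0) (heq : h 0 0 = g 0 0) : g ∈ K := by
  have hinv := hKU (K.inv_mem hh)
  have hmem : h⁻¹ * g ∈ upperTriangular F := mul_mem hinv hg
  have h00 : (h⁻¹ * g) 0 0 = 1 := by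
    rw [mul_apply_zero_zero_of_upper hg, ← heq, ← mul_apply_zero_zero_of_upper (hKU hh)]
    simp
  have := K.mul_mem hh (hN ((h⁻¹ * g) 0 1))
  rwa [← eq_unipotent hmem h00, mul_inv_cancel_left] at this

/-- The subgroups of `U` that contain all unipotent matrices and whose diagonal entries exhaust `Fˣ`
up to sign: these entries form all of `Fˣ` if they include `-1`, and otherwise `-1` is not a square
and they are exactly the squares. -/
theorem eq_upperTriangular_or_square {F : Type*} [Field F] [Finite F] {K : Subgroup SL(2, F)}
    (hKU : K ≤ upperTriangular F) (hN : ∀ t, unipotent t ∈ K)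
    (hsq : ∀ k : F, k ≠ 0 → ∃ h ∈ K, h 0 0 ^ 2 = k ^ 2) :
    K = upperTriangular F ∨ K = upperTriangularSquare F := by
  have hne {g : SL(2, F)} (hg : g 1 0 = 0) : g 0 0 ≠ 0 :=
    left_ne_zero_of_mul_eq_one (mul_eq_one_of_upper hg)
  have hpow {h : SL(2, F)} (hh : h ∈ K) : (h * h) 0 0 = h 0 0 ^ 2 := by
    rw [mul_apply_zero_zero_of_upper (hKU hh), sq]
  by_cases hneg : ∃ h ∈ K, h 0 0 = -1
  · left
    refine le_antisymm hKU fun g hg => ?_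
    obtain ⟨z, hz, hz1⟩ := hneg
    obtain ⟨h, hh, hhg⟩ := hsq _ (hne hg)
    rcases sq_eq_sq_iff_eq_or_eq_neg.mp hhg with h1 | h1
    · exact mem_of_unipotent_mem hKU hN hh hg h1
    · refine mem_of_unipotent_mem hKU hN (K.mul_mem hz hh) hg ?_
      rw [mul_apply_zero_zero_of_upper (hKU hh), hz1, h1, neg_one_mul, neg_neg]
  · right
    push Not at hneg
    have hns : ¬ IsSquare (-1 : F) := by
      rintro ⟨i, hi⟩
      have hi0 : i ≠ 0 := by rintro rfl; simp at hi
      obtain ⟨h, hh, h2⟩ := hsq i hi0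
      exact hneg _ (K.mul_mem hh hh) (by rw [hpow hh, h2, sq, hi])
    refine le_antisymm (fun g hg => ?_) fun g hg => ?_
    · have hg0 : g 1 0 = 0 := hKU hg
      have hs : IsSquare (g 0 0) := by
        by_contra hs
        obtain ⟨r, hr⟩ := isSquare_neg_of_not_isSquare hns hs
        have hr0 : r ≠ 0 := by
          rintro rfl
          exact hne hg0 (by simpa using hr)
        obtain ⟨h, hh, h2⟩ := hsq r hr0
        refine hneg _ (K.mul_mem (K.mul_mem hh hh) (K.inv_mem hg)) ?_
        rw [mul_apply_zero_zero_of_upper (hKU (K.inv_mem hg)), hpow hh, h2, sq, ← hr, neg_mul,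
          ← mul_apply_zero_zero_of_upper (hKU (K.inv_mem hg))]
        simp
      exact ⟨hg0, hs, isSquare_apply_one_one hg0 hs⟩
    · obtain ⟨hg0, ⟨r, hr⟩, -⟩ := hg
      have hr0 : r ≠ 0 := by
        rintro rfl
        exact hne hg0 (by simpa using hr)
      obtain ⟨h, hh, h2⟩ := hsq r hr0
      exact mem_of_unipotent_mem hKU hN (K.mul_mem hh hh) hg0 (by rw [hpow hh, h2, sq, hr])

/-- A subgroup `K` giving a strong Gelfand pair has all of `Fˣ` as diagonal entries up to sign. If
`K` contains a nontrivial unipotent matrix, it contains all of them, and so `K` is `U` or `H₂`.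
Otherwise `K` lies in the centralizer of one of its elements with distinct diagonal entries, which
is conjugate to the diagonal torus. -/
theorem not_isStrongGelfandPair_of_lt {p : ℕ} [Fact p.Prime] (hp : 5 ≤ p)
    {K : Subgroup SL(2, ZMod p)} (hK : K < upperTriangular (ZMod p))
    (hK2 : K ≠ upperTriangularSquare (ZMod p)) : ¬ IsStrongGelfandPair K := by
  intro hSG
  have hsq (k : ZMod p) (hk : k ≠ 0) := hSG.exists_sq_eq hK.le hk
  have hnat {n : ℕ} (hn : 0 < n) (hnp : n < p) : (n : ZMod p) ≠ 0 := by
    rw [Ne, ZMod.natCast_eq_zero_iff]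
    exact Nat.not_dvd_of_pos_of_lt hn hnp
  by_cases hN : ∀ t, unipotent t ∈ K → t = 0
  · have h2 : (2 : ZMod p) ≠ 0 := by exact_mod_cast hnat (n := 2) (by norm_num) (by omega)
    have h3 : (3 : ZMod p) ≠ 0 := by exact_mod_cast hnat (n := 3) (by norm_num) (by omega)
    -- As `2 ^ 2 ≠ 1`, the diagonal entries of `h` are distinct.
    obtain ⟨h, hh, hh2⟩ := hsq 2 h2
    have hh0 : h 1 0 = 0 := hK.le hh
    have hh1 := mul_eq_one_of_upper hh0
    have hd : h 0 0 - h 1 1 ≠ 0 := by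
      intro hd
      apply h3
      linear_combination h 0 0 * hd + hh1 - hh2
    obtain ⟨ν, hν⟩ := FiniteField.exists_nonsquare (F := ZMod p) (by
      rw [ZMod.ringChar_zmod_n]; omega)
    refine not_isStrongGelfandPair_of_torus (h 0 1 / (h 0 0 - h 1 1)) (fun g hg => ?_) hν hSG
    refine ⟨hK.le hg, ?_⟩
    have := congrArg (fun z : SL(2, ZMod p) => z 0 1)
      (mul_comm_of_forall_unipotent_mem hK.le hN hg hh)
    simp only [sl_mul_apply] at this
    field_simp
    linear_combination -this
  · push Not at hN
    obtain ⟨t, ht, ht0⟩ := hN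
    rcases eq_upperTriangular_or_square hK.le (unipotent_mem_of_ne_zero ht0 ht) hsq with h | h
    · exact hK.ne h
    · exact hK2 h

theorem not_isStrongGelfandPair_upperTriangularSquare {F : Type*} [Field F] [Finite F]
    [Fintype SL(2, F)] (hF : ringChar F ≠ 2) (h1 : IsSquare (-1 : F)) :
    ¬ IsStrongGelfandPair (upperTriangularSquare F) := by
  intro hSG
  obtain ⟨ν, hν⟩ := FiniteField.exists_nonsquare hF
  have hν0 : ν ≠ 0 := by rintro rfl; exact hν IsSquare.zero
  obtain ⟨h, hh, h2⟩ := hSG.exists_sq_eq upperTriangularSquare_le hν0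
  rcases sq_eq_sq_iff_eq_or_eq_neg.mp h2 with h2 | h2
  · exact hν (h2 ▸ hh.2.1)
  · refine hν ?_
    rw [← neg_neg ν, ← h2, ← neg_one_mul]
    exact h1.mul hh.2.1

/-- If `-1` is not a square then `U` is generated by `H₂` and the central element `-1`, so the Hecke
algebras of `H₂` and `U` agree. -/
theorem isStrongGelfandPair_upperTriangularSquare {F : Type*} [Field F] [Finite F]
    [Fintype SL(2, F)] (h1 : ¬ IsSquare (-1 : F)) :
    IsStrongGelfandPair (upperTriangularSquare F) := by
  have hle {a : MonoidAlgebra ℂ SL(2, F)} (ha : a ∈ heckeAlgebra (upperTriangularSquare F)) :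
      a ∈ heckeAlgebra (upperTriangular F) := by
    refine mem_heckeAlgebra_of_coeff_conj fun h hh g => ?_
    have hh0 : h 1 0 = 0 := hh
    by_cases hs : IsSquare (h 0 0)
    · exact coeff_conj_of_mem_heckeAlgebra ha ⟨hh0, hs, isSquare_apply_one_one hh0 hs⟩ g
    · have hs' := isSquare_neg_of_not_isSquare h1 hs
      have hn0 : (-h) 1 0 = 0 := by simp [hh0]
      have hn1 : IsSquare ((-h) 0 0) := by simpa using hs'
      have := coeff_conj_of_mem_heckeAlgebra ha ⟨hn0, hn1, isSquare_apply_one_one hn0 hn1⟩ g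
      simpa using this
  exact isStrongGelfandPair_of_commute fun a ha b hb =>
    commute_heckeAlgebra_of_antiinvolution antitranspose antitranspose_involutive antitranspose_mul
      (fun g hg => exists_antitranspose_eq_conj hg) (hle ha) (hle hb)

end StrongGelfand

open scoped MatrixGroups in
theorem mainTheorem3 (p : ℕ) [Fact p.Prime] (hp : 13 ≤ p) :
    (∀ K : Subgroup SL(2, ZMod p), K < StrongGelfand.upperTriangular (ZMod p) →
      K ≠ StrongGelfand.upperTriangularSquare (ZMod p) →
      ¬ StrongGelfand.IsStrongGelfandPair K) ∧
    (p ≡ 1 [MOD 4] →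
      ¬ StrongGelfand.IsStrongGelfandPair (StrongGelfand.upperTriangularSquare (ZMod p))) ∧
    (p ≡ 3 [MOD 4] →
      StrongGelfand.IsStrongGelfandPair (StrongGelfand.upperTriangularSquare (ZMod p))) ∧
    (∀ K : Subgroup SL(2, ZMod p), K < StrongGelfand.upperTriangularSquare (ZMod p) →
      ¬ StrongGelfand.IsStrongGelfandPair K) := by
  refine ⟨fun K hK hK2 => StrongGelfand.not_isStrongGelfandPair_of_lt (by omega) hK hK2,
    fun h => ?_, fun h => ?_, fun K hK => ?_⟩
  · refine StrongGelfand.not_isStrongGelfandPair_upperTriangularSquare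
      (by rw [ZMod.ringChar_zmod_n]; omega) (ZMod.exists_sq_eq_neg_one_iff.mpr ?_)
    unfold Nat.ModEq at h
    omega
  · refine StrongGelfand.isStrongGelfandPair_upperTriangularSquare
      (mt ZMod.exists_sq_eq_neg_one_iff.mp ?_)
    unfold Nat.ModEq at h
    omega
  · exact StrongGelfand.not_isStrongGelfandPair_of_lt (by omega)
      (hK.trans_le StrongGelfand.upperTriangularSquare_le) hK.ne
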